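/- Let $Q_n$ be the $n$-dimensional hypercube graph, whose vertices are the bit vectors in $\{0,1\}^n$, two of them being adjacent exactly when they differ in a single entry. Let $h=h_0h_1\cdots h_{2^n-1}$ be a Hamiltonian cycle of $Q_n$ (indices modulo $2^n$). A $4$-cycle $v_0v_1v_2v_3$ of $Q_n$ is called a straight square within $h$ if there are indices $i,j$ with $h_ih_{i+1}h_jh_{j+1}=v_0v_1v_2v_3$, and a twisted square within $h$ if there are indices $i,j$ with $h_ih_{i+1}h_jh_{j+1}=v_0v_1v_3v_2$. Theorem. For every integer $n$ with $2\le n\le 7$, every Hamiltonian cycle of $Q_n$ contains an inscribed square, that is, some $4$-cycle of $Q_n$ is a straight or a twisted square within it. In other words, every Hamiltonian cycle of $Q_n$ contains two opposite edges of some $4$-cycle of $Q_n$. -/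

import Mathlib

/-- The `n`-dimensional hypercube `Q_n`: its vertices are the vectors of `n` bits, and its edges
are the pairs `{v, v + e_i}`, where `e_i` is the `i`-th canonical basis vector and addition is
modulo 2. -/
def hypercube (n : ℕ) : SimpleGraph (Fin n → ZMod 2) where
  Adj u v := ∃ i : Fin n, v = u + Pi.single i 1
  symm := by
    constructor
    rintro u v ⟨i, rfl⟩
    refine ⟨i, ?_⟩
    rw [add_assoc, ← Pi.single_add, CharTwo.add_self_eq_zero, Pi.single_zero, add_zero]
  loopless := by
    constructor
    rintro u ⟨i, h⟩
    have h1 := congrFun h i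
    simp at h1

namespace SimpleGraph

variable {V : Type*} {G : SimpleGraph V}

/-- `v₀ v₁ v₂ v₃` is a `4`-cycle of `G`: four pairwise different vertices, cyclically adjacent. -/
def IsFourCycle (G : SimpleGraph V) (v₀ v₁ v₂ v₃ : V) : Prop :=
  [v₀, v₁, v₂, v₃].Nodup ∧ G.Adj v₀ v₁ ∧ G.Adj v₁ v₂ ∧ G.Adj v₂ v₃ ∧ G.Adj v₃ v₀

/-- The `4`-cycle `v₀ v₁ v₂ v₃` is a straight square within the closed walk `h = h₀ h₁ ⋯`:
`h_i h_{i+1} h_j h_{j+1} = v₀ v₁ v₂ v₃` for some indices `i`, `j`. For the last index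
`i = h.length - 1`, the vertex `h_{i+1}` is the start `h₀`, because the walk is closed. -/
def Walk.IsStraightSquare {a : V} (h : G.Walk a a) (v₀ v₁ v₂ v₃ : V) : Prop :=
  G.IsFourCycle v₀ v₁ v₂ v₃ ∧
    ∃ i < h.length, ∃ j < h.length,
      h.getVert i = v₀ ∧ h.getVert (i + 1) = v₁ ∧ h.getVert j = v₂ ∧ h.getVert (j + 1) = v₃

/-- The `4`-cycle `v₀ v₁ v₂ v₃` is a twisted square in the closed walk `h = h₀ h₁ ⋯`:
`h_i h_{i+1} h_j h_{j+1} = v₀ v₁ v₃ v₂` for some indices `i`, `j`. -/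
def Walk.IsTwistedSquare {a : V} (h : G.Walk a a) (v₀ v₁ v₂ v₃ : V) : Prop :=
  G.IsFourCycle v₀ v₁ v₂ v₃ ∧
    ∃ i < h.length, ∃ j < h.length,
      h.getVert i = v₀ ∧ h.getVert (i + 1) = v₁ ∧ h.getVert j = v₃ ∧ h.getVert (j + 1) = v₂

/-- The closed walk `h` contains a square (a square is inscribed in `h`): some `4`-cycle is a
straight or a twisted square within `h`. -/
def Walk.ContainsSquare {a : V} (h : G.Walk a a) : Prop :=
  ∃ v₀ v₁ v₂ v₃ : V, h.IsStraightSquare v₀ v₁ v₂ v₃ ∨ h.IsTwistedSquare v₀ v₁ v₂ v₃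

end SimpleGraph

/-! If no square is inscribed, the edges of the cycle form a spanning 2-regular subgraph without two
opposite edges of a 4-cycle; only this is used (`IsSquareFreeFactor`).

Call `{j, k}` a double at `v` if the corner opposite to `v` of the square at `v` in directions `j`,
`k` has its two chosen edges in that square. Each vertex is that opposite corner for exactly one
double, so the average number of doubles per vertex is 1 (2 as ordered pairs, `sum_card_doubles`).
On the other hand, let `O` be the `n - 2` directions not chosen at `v`. For `j` in `O`, the
neighbour `v + e_j` has two chosen directions, both in `O` and different from `j`. This gives
`2(n-2)` arcs on `O`, and two opposite arcs form a double. Hence `v` has at least `2(n-2) -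
(n-2)(n-3)/2 = (n-2)(7-n)/2` doubles, more than 1 for `3 ≤ n ≤ 6`; the case `n = 2` is immediate.

For `n = 7` the bound is 0. If some vertex has no double, the arcs there form a regular tournament
on five directions, which is unique up to isomorphism. Otherwise every vertex has exactly one
double. Up to an automorphism of the cube each case prescribes a few edges, and a backtracking
search evaluated by the kernel refutes them (`refute_tournament`, `refute_double`). -/

/-! ### Partial edge sets of `Q₇` as bit vectors

A set of pairs (direction `i`, vertex `x`) with `i < 7` and `x < 128` is stored as a natural number,
the pair `(i, x)` being bit `128 * i + x`. All definitions below are meant for evaluation in the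
kernel; they use the operations on `ℕ` that the kernel evaluates natively. -/

namespace CubeBits

def label (_ x : ℕ) : ℕ := x

/-- `forceNat x k` is `k x`, but `x` is evaluated to a literal before `k` is applied. The label, a
residue of the literal, makes the terms built from different literals hash differently. -/
def forceNat {α : Type} (x : ℕ) (k : ℕ → α) : α :=
  Nat.rec (k 0) (fun n _ => Nat.rec (k (Nat.succ n)) (fun m _ => k (label m (Nat.succ n)))
    (Nat.mod n 1000003)) x

theorem forceNat_eq {α : Type} (x : ℕ) (k : ℕ → α) : forceNat x k = k x := by
  cases x with
  | zero => rfl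
  | succ n =>
    change Nat.rec (k n.succ) (fun m _ => k (label m n.succ)) (Nat.mod n 1000003) = k n.succ
    cases Nat.mod n 1000003 <;> rfl

def allBits : ℕ := 2 ^ 896 - 1

/-- The pairs `(i, x)` such that bit `j` of `x` vanishes. -/
def lowMask (j : ℕ) : ℕ := allBits / (2 ^ 2 ^ j + 1)

/-- The pairs with first component `i`. -/
def block (i : ℕ) : ℕ := Nat.shiftLeft (2 ^ 128 - 1) (128 * i)

/-- The second component `x` of every pair is replaced by its neighbour in direction `j`. -/
def translate (j X : ℕ) : ℕ :=
  Nat.lor (Nat.land (Nat.shiftRight X (2 ^ j)) (lowMask j))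
    (Nat.shiftLeft (Nat.land X (lowMask j)) (2 ^ j))

/-- The first component of every pair is decreased by `r` modulo `7`. -/
def rotate (r X : ℕ) : ℕ :=
  Nat.lor (Nat.shiftRight X (128 * r)) (Nat.land (Nat.shiftLeft X (128 * (7 - r))) allBits)

/-- The set of `x` such that `(i, x)` is a member. -/
def slice (i X : ℕ) : ℕ := Nat.land (Nat.shiftRight X (128 * i)) (2 ^ 128 - 1)

def atLeastOne {α : Type} (f : α → ℕ) (l : List α) : ℕ :=
  List.rec 0 (fun a _ ih => Nat.lor (f a) ih) l

def allOf {α : Type} (f : α → ℕ) (l : List α) : ℕ :=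
  List.rec allBits (fun a _ ih => Nat.land (f a) ih) l

def atLeastTwo {α : Type} (f : α → ℕ) (l : List α) : ℕ :=
  List.rec 0 (fun a l ih => Nat.lor (Nat.land (f a) (atLeastOne f l)) ih) l

def allButOne {α : Type} (f : α → ℕ) (l : List α) : ℕ :=
  List.rec allBits (fun a l ih => Nat.lor (allOf f l) (Nat.land (f a) ih)) l

def directions : List ℕ := [0, 1, 2, 3, 4, 5, 6]

/-- An edge is seen from both ends; and a direction is forced at a vertex when at least five of the
other six are excluded there. -/
def nextT (T F : ℕ) : ℕ :=
  Nat.lor (Nat.lor T (atLeastOne (fun j => Nat.land (translate j T) (block j)) directions))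
    (allButOne (fun r => rotate r F) [1, 2, 3, 4, 5, 6])

/-- An edge excludes its parallel translates, a non-edge is seen from both ends, and two edges at a
vertex exclude the other directions. -/
def nextF (T F : ℕ) : ℕ :=
  Nat.lor
    (Nat.lor F (atLeastOne (fun j =>
      Nat.lor (Nat.land (translate j T) (Nat.xor allBits (block j)))
        (Nat.land (translate j F) (block j))) directions))
    (atLeastTwo (fun r => rotate r T) [1, 2, 3, 4, 5, 6])

/-- The vertices whose neighbour in direction `j` is incident with direction `k`. -/
def arc (T j k : ℕ) : ℕ := slice k (translate j T)

def double (T j k : ℕ) : ℕ := Nat.land (arc T j k) (arc T k j)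

def pairs : List (ℕ × ℕ) := [(0, 1), (0, 2), (0, 3), (0, 4), (0, 5), (0, 6), (1, 2), (1, 3), (1, 4),
  (1, 5), (1, 6), (2, 3), (2, 4), (2, 5), (2, 6), (3, 4), (3, 5), (3, 6), (4, 5), (4, 6), (5, 6)]

/-- Vertices with a known double other than `{j, k}`: either two doubles are known, or one is and
`{j, k}` is not. The `cond`s sort `j`, `k` as in `pairs`. -/
def otherDouble (T one two j k : ℕ) : ℕ :=
  Nat.lor two (Nat.xor one (Nat.land one
    (double T (cond (Nat.ble j k) j k) (cond (Nat.ble j k) k j))))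

/-- If `x` already has another double, then `{j, k}` must not become one: an edge of direction `k`
at `x + e_j` excludes the edge of direction `j` at `x + e_k`. -/
def doubleF (T : ℕ) : ℕ :=
  forceNat (atLeastOne (fun p => double T p.1 p.2) pairs) fun one =>
  forceNat (atLeastTwo (fun p => double T p.1 p.2) pairs) fun two =>
  atLeastOne (fun k => translate k (atLeastOne (fun j => cond (Nat.beq j k) 0 (Nat.land (block j)
    (Nat.shiftLeft (Nat.land (otherDouble T one two j k) (arc T j k)) (128 * j)))) directions))
    directions

/-- Backtracking search for a contradiction from the pairs `T` assumed to be edges and the pairs `F`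
assumed to be non-edges. The list holds the pairs to branch on, in preorder; the unused part of it
is returned. -/
def refute (b : Bool) (n : ℕ) : ℕ → ℕ → List ℕ → Option (List ℕ) :=
  Nat.rec (fun _ _ _ => none)
    (fun _ ih T F hs =>
      forceNat (nextT T F) fun T' =>
      forceNat (nextF T F) fun F' =>
      cond (Nat.beq (Nat.land T' F') 0)
        (cond (cond (Nat.beq T T') (Nat.beq F F') false)
          (forceNat (cond b (Nat.lor F (doubleF T)) F) fun F' =>
            cond (Nat.beq F F')
              (List.casesOn hs none fun h hs =>
                cond (Nat.ble h 895)
                  (Option.casesOn (ih (Nat.lor T (2 ^ h)) F hs) none fun hs =>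
                    ih T (Nat.lor F (2 ^ h)) hs)
                  none)
              (ih T F' hs))
          (ih T' F' hs))
        (some hs)) n

/-! ### Starting configurations and branching data for the two searches. -/

def edgeSet (l : List (ℕ × ℕ)) : ℕ :=
  atLeastOne (fun p => 2 ^ (128 * p.1 + p.2)) l

/-- The vertex `0` is on edges of the directions `5` and `6`, and its neighbour in direction `j < 5`
is on edges of the directions `j + 1` and `j + 2` modulo `5`. -/
def tournamentEdges : List (ℕ × ℕ) := [(5, 0), (6, 0), (1, 1), (2, 1), (2, 2), (3, 2), (3, 4),
  (4, 4), (4, 8), (0, 8), (0, 16), (1, 16)]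

/-- The vertex `0` is on edges of the directions `5` and `6`, and `{0, 1}` is a double there. -/
def doubleEdges : List (ℕ × ℕ) := [(5, 0), (6, 0), (1, 1), (0, 2)]

/-- Entries encode pairs as `128 * i + x`. They only guide the search: soundness holds for any list.
-/
def tournamentBranches : List ℕ := [
  805, 44, 774, 779, 523, 643, 6, 714, 216, 652, 661, 141, 789, 658, 809, 419, 785, 659, 405,
  153, 667, 722, 582, 643, 647, 406, 666, 775, 660, 661, 515, 724, 337, 651, 649, 267, 781, 353,
  810, 184, 780, 789, 141, 661, 658, 709, 76, 646, 651, 523, 643, 6, 818, 550, 771, 647, 523,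
  275, 663, 820, 305, 779, 649, 267, 653, 353, 713, 451, 657, 659, 267, 653, 14, 527, 787, 650,
  666, 515, 32, 653, 790, 658, 423, 169, 299, 557, 307, 435, 312, 58, 98, 482, 651, 267, 525,
  14, 652, 647, 406, 140, 660, 149, 817, 645, 646, 417, 609, 808, 360, 232, 650, 649, 515, 647,
  659, 643, 785, 661, 666, 645, 662, 658, 547, 267, 42, 160, 141, 651, 168, 34, 556, 527, 283,
  173, 46, 803, 787, 551, 304, 652, 545, 804, 546, 666, 267, 645, 655, 803, 298, 557, 815, 576,
  707, 616, 106, 544, 811, 164, 804, 38, 160, 141, 405, 22, 779, 651, 106, 645, 651, 824, 649,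
  481, 779, 527, 283, 312, 64, 449, 200, 66, 331, 780, 668, 662, 647, 774, 577, 323, 330, 783,
  403, 275, 14, 407, 663, 791, 707, 643, 22, 177, 22, 401, 650, 304, 617, 56, 525, 391, 140, 14,
  141, 526, 657, 177, 660, 406, 650]

def doubleBranches : List ℕ := [
  288, 801, 802, 291, 553, 554, 433, 434, 481, 609, 482, 610, 417, 517, 518, 647, 649, 650, 273,
  274, 659, 36, 165, 257, 4, 389, 390, 647, 265, 266, 651, 657, 658, 36, 165, 257, 4, 448, 705,
  706, 451, 581, 582, 337, 338, 353, 609, 354, 610, 321, 773, 774, 521, 522, 779, 401, 402, 787,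
  801, 544, 802, 68, 196, 197, 96, 389, 390, 775, 265, 266, 779, 785, 786, 801, 544, 802, 72,
  201, 257, 388, 544, 801, 802, 547, 421, 422, 297, 298, 353, 481, 354, 482, 289, 645, 646, 521,
  522, 651, 401, 402, 659, 36, 164, 165, 38, 391, 267, 4, 132, 652, 264, 8, 136, 173, 650, 517,
  518, 647, 649, 650, 273, 274, 659, 40, 168, 169, 42, 267, 391, 8, 136, 328, 64, 64, 160, 352,
  484, 612, 616, 496, 100, 645, 289, 419, 545, 480, 228, 645, 289, 419, 385, 804, 452, 4, 148,
  582, 716, 420, 432, 16, 646, 552, 385, 8, 646, 420, 132, 20, 549, 812, 452, 464, 144, 773,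
  584, 385, 136, 773, 801, 291, 706, 323, 423, 551, 555, 435, 455, 583, 587, 467, 483, 225, 801,
  802, 352, 224, 419, 549, 550, 305, 306, 713, 355, 712, 706, 322, 386, 257, 257, 164, 196, 132,
  577, 323, 449, 192, 32, 388, 578, 646, 775, 521, 777, 8, 391, 450, 646, 775, 777, 778, 12, 8,
  264, 390, 388, 266, 391, 779, 16, 785, 524, 320, 385, 168, 200, 705, 451, 321, 322, 773, 774,
  779, 273, 785, 272, 192, 16, 578, 517, 773, 516, 192, 4, 32, 801, 802, 352, 96, 225, 258, 176,
  208, 144, 321, 579, 449, 192, 32, 520, 322, 773, 774, 265, 777, 8, 72, 650, 450, 389, 773,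
  388, 68, 320, 786, 576]

set_option maxRecDepth 100000 in
-- The rule on doubles is switched off: one vertex without doubles says nothing about the number at
-- other vertices. The fuel 1000 bounds the length of a path in the search tree.
theorem refute_tournament :
    (refute false 1000 (edgeSet tournamentEdges) 0 tournamentBranches).isSome = true := by decide +kernel

set_option maxRecDepth 100000 in
theorem refute_double :
    (refute true 1000 (edgeSet doubleEdges) 0 doubleBranches).isSome = true := by decide +kernel

end CubeBits

/-! ### Bit operations read as operations on sets of pairs. -/

namespace CubeBits

/-- `S i x` says that `(i, x)` is an edge, for a square-free spanning `2`-regular subgraph of `Q₇`. -/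
structure IsModel (S : ℕ → ℕ → Prop) : Prop where
  symm : ∀ {i x}, S i x → S i (x ^^^ 2 ^ i)
  free : ∀ {i j x}, j < 7 → i ≠ j → S i x → ¬ S i (x ^^^ 2 ^ j)
  card : ∀ x, ∃ a < 7, ∃ b < 7, a ≠ b ∧ ∀ i, S i x ↔ i = a ∨ i = b

/-- At each vertex, at most one pair of directions is a double. -/
def AtMostOneDouble (S : ℕ → ℕ → Prop) : Prop :=
  ∀ ⦃x j k l m⦄, j < k → k < 7 → l < m → m < 7 → S k (x ^^^ 2 ^ j) → S j (x ^^^ 2 ^ k) →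
    S m (x ^^^ 2 ^ l) → S l (x ^^^ 2 ^ m) → j = l ∧ k = m

/-- All members of the set `X` of pairs have the property `P`. -/
def Within (X : ℕ) (P : ℕ → ℕ → Prop) : Prop :=
  ∀ i x, x < 128 → X.testBit (128 * i + x) = true → i < 7 ∧ P i x

theorem testBit_lor (X Y b : ℕ) : (Nat.lor X Y).testBit b = (X.testBit b || Y.testBit b) :=
  Nat.testBit_or X Y b

theorem testBit_land (X Y b : ℕ) : (Nat.land X Y).testBit b = (X.testBit b && Y.testBit b) :=
  Nat.testBit_and X Y b

theorem testBit_xor (X Y b : ℕ) : (Nat.xor X Y).testBit b = (X.testBit b ^^ Y.testBit b) :=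
  Nat.testBit_xor X Y b

theorem testBit_shiftRight (X k b : ℕ) : (Nat.shiftRight X k).testBit b = X.testBit (k + b) :=
  Nat.testBit_shiftRight X

theorem testBit_shiftLeft (X k b : ℕ) :
    (Nat.shiftLeft X k).testBit b = (decide (k ≤ b) && X.testBit (b - k)) :=
  Nat.testBit_shiftLeft X

theorem testBit_allBits (b : ℕ) : allBits.testBit b = decide (b < 896) := by
  rw [allBits, Nat.testBit_two_pow_sub_one]

theorem testBit_block (j i x : ℕ) (hx : x < 128) :
    (block j).testBit (128 * i + x) = decide (i = j) := by
  rw [block, testBit_shiftLeft, Nat.testBit_two_pow_sub_one, ← Bool.decide_and]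
  exact decide_eq_decide.2 (by omega)

theorem testBit_slice (i X x : ℕ) (hx : x < 128) :
    (slice i X).testBit x = X.testBit (128 * i + x) := by
  rw [slice, testBit_land, testBit_shiftRight, Nat.testBit_two_pow_sub_one]
  simp [hx]

theorem lt_of_testBit_slice {i X x : ℕ} (h : (slice i X).testBit x = true) : x < 128 := by
  rw [slice, testBit_land, Nat.testBit_two_pow_sub_one] at h
  simp_all

/-- On masked positions, flipping bit `j` is adding `2 ^ j` without carry into the next block, so a
shift performs it. Only this implication is needed, as soundness tolerates lost pairs. -/
theorem lowMask_spec : ∀ j < 7, ∀ c < 896, (lowMask j).testBit c = true →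
    (c % 128) ^^^ 2 ^ j = c % 128 + 2 ^ j ∧ c % 128 + 2 ^ j < 128 := by
  decide +kernel

set_option exponentiation.threshold 1000 in
theorem lt_of_testBit_lowMask {j c : ℕ} (h : (lowMask j).testBit c = true) : c < 896 := by
  have h1 := (Nat.ge_two_pow_of_testBit h).trans (Nat.div_le_self _ _)
  have h2 : allBits < 2 ^ 896 := Nat.lt_pow_two_of_testBit _ fun i hi => by
    rw [testBit_allBits, decide_eq_false_iff_not]
    omega
  exact (Nat.pow_lt_pow_iff_right one_lt_two).1 (h1.trans_lt h2)

theorem xor_two_pow_lt {x j : ℕ} (hx : x < 128) (hj : j < 7) : x ^^^ 2 ^ j < 128 :=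
  Nat.xor_lt_two_pow (n := 7) hx (Nat.pow_lt_pow_right (by norm_num) hj)

theorem xor_two_pow_self (x j : ℕ) : (x ^^^ 2 ^ j) ^^^ 2 ^ j = x := by
  rw [Nat.xor_assoc, Nat.xor_self, Nat.xor_zero]

theorem testBit_translate {j X i x : ℕ} (hj : j < 7) (hx : x < 128)
    (h : (translate j X).testBit (128 * i + x) = true) :
    i < 7 ∧ X.testBit (128 * i + (x ^^^ 2 ^ j)) = true := by
  rw [translate, testBit_lor, testBit_land, testBit_shiftRight, testBit_shiftLeft, testBit_land,
    Bool.or_eq_true, Bool.and_eq_true, Bool.and_eq_true, Bool.and_eq_true, decide_eq_true_eq] at h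
  rcases h with ⟨h1, h2⟩ | ⟨h0, h1, h2⟩
  · have hlt := lt_of_testBit_lowMask h2
    obtain ⟨h3, -⟩ := lowMask_spec j hj _ hlt h2
    have h4 : (128 * i + x) % 128 = x := by omega
    rw [h4] at h3
    refine ⟨by omega, ?_⟩
    rw [h3]
    convert h1 using 2
    omega
  · have hlt := lt_of_testBit_lowMask h2
    obtain ⟨h3, h4⟩ := lowMask_spec j hj _ hlt h2
    have h5 : x = (128 * i + x - 2 ^ j) % 128 + 2 ^ j := by omega
    have h6 : x ^^^ 2 ^ j = (128 * i + x - 2 ^ j) % 128 := by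
      conv_lhs => rw [h5, ← h3]
      exact xor_two_pow_self _ _
    refine ⟨by omega, ?_⟩
    rw [h6]
    convert h1 using 2
    omega

theorem Within.rotate {X : ℕ} {P : ℕ → ℕ → Prop} (h : Within X P) {r : ℕ} (hr : r ≤ 6) :
    Within (rotate r X) fun i x => P ((i + r) % 7) x := by
  intro i x hx hb
  rw [CubeBits.rotate, testBit_lor, testBit_shiftRight, testBit_land, testBit_shiftLeft,
    testBit_allBits, Bool.or_eq_true, Bool.and_eq_true, Bool.and_eq_true, decide_eq_true_eq,
    decide_eq_true_eq] at hb
  rcases hb with h1 | ⟨⟨h0, h1⟩, h2⟩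
  · have h3 := h (i + r) x hx (by convert h1 using 2; ring)
    refine ⟨by omega, ?_⟩
    change P ((i + r) % 7) x
    rw [Nat.mod_eq_of_lt h3.1]
    exact h3.2
  · have h3 := h (i + r - 7) x hx (by convert h1 using 2; omega)
    have h4 : (i + r) % 7 = i + r - 7 := by omega
    refine ⟨by omega, ?_⟩
    change P ((i + r) % 7) x
    rw [h4]
    exact h3.2

theorem Within.lor {X Y : ℕ} {P : ℕ → ℕ → Prop} (hX : Within X P) (hY : Within Y P) :
    Within (Nat.lor X Y) P := by
  intro i x hx hb
  rw [testBit_lor, Bool.or_eq_true] at hb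
  exact hb.elim (hX i x hx) (hY i x hx)

section Lists

variable {α : Type} {f : α → ℕ} {l : List α} {b : ℕ}

theorem testBit_atLeastOne (h : (atLeastOne f l).testBit b = true) :
    ∃ a ∈ l, (f a).testBit b = true := by
  induction l with
  | nil => exact absurd h (by simp [atLeastOne])
  | cons a l ih =>
    rw [show atLeastOne f (a :: l) = Nat.lor (f a) (atLeastOne f l) from rfl, testBit_lor,
      Bool.or_eq_true] at h
    rcases h with h | h
    · exact ⟨a, by simp, h⟩
    · obtain ⟨c, hc, h⟩ := ih h
      exact ⟨c, by simp [hc], h⟩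

theorem testBit_atLeastTwo (hl : l.Nodup) (h : (atLeastTwo f l).testBit b = true) :
    ∃ a ∈ l, ∃ c ∈ l, a ≠ c ∧ (f a).testBit b = true ∧ (f c).testBit b = true := by
  induction l with
  | nil => exact absurd h (by simp [atLeastTwo])
  | cons a l ih =>
    rw [show atLeastTwo f (a :: l) = Nat.lor (Nat.land (f a) (atLeastOne f l)) (atLeastTwo f l)
      from rfl, testBit_lor, testBit_land, Bool.or_eq_true, Bool.and_eq_true] at h
    rw [List.nodup_cons] at hl
    rcases h with ⟨h1, h2⟩ | h
    · obtain ⟨c, hc, h⟩ := testBit_atLeastOne h2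
      exact ⟨a, by simp, c, by simp [hc], fun h => hl.1 (h ▸ hc), h1, h⟩
    · obtain ⟨c, hc, d, hd, h⟩ := ih hl.2 h
      exact ⟨c, by simp [hc], d, by simp [hd], h⟩

theorem testBit_allOf (h : (allOf f l).testBit b = true) : ∀ a ∈ l, (f a).testBit b = true := by
  induction l with
  | nil => simp
  | cons a l ih =>
    rw [show allOf f (a :: l) = Nat.land (f a) (allOf f l) from rfl, testBit_land,
      Bool.and_eq_true] at h
    simpa using ⟨h.1, ih h.2⟩

theorem testBit_allButOne (h : (allButOne f l).testBit b = true) :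
    ∀ a ∈ l, ∀ c ∈ l, a ≠ c → (f a).testBit b = true ∨ (f c).testBit b = true := by
  induction l with
  | nil => simp
  | cons d l ih =>
    rw [show allButOne f (d :: l) = Nat.lor (allOf f l) (Nat.land (f d) (allButOne f l)) from rfl,
      testBit_lor, testBit_land, Bool.or_eq_true, Bool.and_eq_true] at h
    intro a ha c hc hac
    rw [List.mem_cons] at ha hc
    rcases h with h | ⟨h1, h2⟩
    · have := testBit_allOf h
      rcases ha with rfl | ha
      · exact Or.inr (this c (hc.resolve_left hac.symm))
      · exact Or.inl (this a ha)
    · rcases ha with rfl | ha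
      · exact Or.inl h1
      · rcases hc with rfl | hc
        · exact Or.inr h1
        · exact ih h2 a ha c hc hac

end Lists

theorem Within.atLeastOne {α : Type} {f : α → ℕ} {l : List α} {P : ℕ → ℕ → Prop}
    (h : ∀ a ∈ l, Within (f a) P) : Within (atLeastOne f l) P := by
  intro i x hx hb
  obtain ⟨a, ha, hb⟩ := testBit_atLeastOne hb
  exact h a ha i x hx hb

theorem lt_of_mem_directions : ∀ {j}, j ∈ directions → j < 7 := by
  decide

/-- The six proper rotations bring every other direction into position `i`. -/
theorem mem_rotations {i a : ℕ} (hi : i < 7) (ha : a < 7) (h : i ≠ a) :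
    (a + 7 - i) % 7 ∈ [1, 2, 3, 4, 5, 6] ∧ (i + (a + 7 - i) % 7) % 7 = a := by
  constructor
  · have : (a + 7 - i) % 7 ≠ 0 ∧ (a + 7 - i) % 7 < 7 := by omega
    generalize (a + 7 - i) % 7 = r at this
    simp only [List.mem_cons, List.not_mem_nil, or_false]
    omega
  · omega

theorem mem_rotations_iff {r : ℕ} : r ∈ [1, 2, 3, 4, 5, 6] ↔ 1 ≤ r ∧ r ≤ 6 := by
  simp only [List.mem_cons, List.not_mem_nil, or_false]
  omega

/-! ### Soundness of the deduction rules and of the search. -/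

section Sound

variable {S : ℕ → ℕ → Prop} {T F : ℕ}

theorem Within.nextT (hS : IsModel S) (hT : Within T S) (hF : Within F fun i x => ¬ S i x) :
    Within (nextT T F) S := by
  refine (hT.lor (Within.atLeastOne fun j hj i x hx hb => ?_)).lor fun i x hx hb => ?_
  · have hj := lt_of_mem_directions hj
    rw [testBit_land, Bool.and_eq_true, testBit_block _ _ _ hx, decide_eq_true_eq] at hb
    obtain ⟨hb, rfl⟩ := hb
    obtain ⟨hi, hb⟩ := testBit_translate hj hx hb
    refine ⟨hi, ?_⟩
    have := hS.symm (hT _ _ (xor_two_pow_lt hx hj) hb).2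
    rwa [xor_two_pow_self] at this
  · have hr : ∀ r ∈ [1, 2, 3, 4, 5, 6], (CubeBits.rotate r F).testBit (128 * i + x) = true →
        i < 7 ∧ ¬ S ((i + r) % 7) x := fun r hr h =>
      hF.rotate (mem_rotations_iff.1 hr).2 i x hx h
    have hb := testBit_allButOne hb
    have hi : i < 7 := by
      rcases hb 1 (by simp) 2 (by simp) (by simp) with h | h
      · exact (hr 1 (by simp) h).1
      · exact (hr 2 (by simp) h).1
    refine ⟨hi, ?_⟩
    obtain ⟨a, ha, b, hb', hab, hab'⟩ := hS.card x
    -- Otherwise both edges `a`, `b` at `x` lie among the six other directions, of which at most one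
    -- is not known to be excluded.
    by_contra hn
    rw [hab', not_or] at hn
    obtain ⟨ha1, ha2⟩ := mem_rotations hi ha hn.1
    obtain ⟨hb1, hb2⟩ := mem_rotations hi hb' hn.2
    rcases hb _ ha1 _ hb1 (by omega) with h | h
    · have := (hr _ ha1 h).2
      rw [ha2] at this
      exact this ((hab' a).2 (Or.inl rfl))
    · have := (hr _ hb1 h).2
      rw [hb2] at this
      exact this ((hab' b).2 (Or.inr rfl))

theorem Within.nextF (hS : IsModel S) (hT : Within T S) (hF : Within F fun i x => ¬ S i x) :
    Within (nextF T F) fun i x => ¬ S i x := by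
  refine (hF.lor (Within.atLeastOne fun j hj => Within.lor (fun i x hx hb => ?_)
    fun i x hx hb => ?_)).lor fun i x hx hb => ?_
  · have hj := lt_of_mem_directions hj
    rw [testBit_land, Bool.and_eq_true, testBit_xor, testBit_allBits,
      testBit_block _ _ _ hx] at hb
    obtain ⟨hb, h⟩ := hb
    obtain ⟨hi, hb⟩ := testBit_translate hj hx hb
    have hij : i ≠ j := by
      rintro rfl
      have : 128 * i + x < 896 := by omega
      simp [this] at h
    refine ⟨hi, ?_⟩
    have := hS.free hj hij (hT _ _ (xor_two_pow_lt hx hj) hb).2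
    rwa [xor_two_pow_self] at this
  · have hj := lt_of_mem_directions hj
    rw [testBit_land, Bool.and_eq_true, testBit_block _ _ _ hx, decide_eq_true_eq] at hb
    obtain ⟨hb, rfl⟩ := hb
    obtain ⟨hi, hb⟩ := testBit_translate hj hx hb
    exact ⟨hi, fun h => (hF _ _ (xor_two_pow_lt hx hj) hb).2 (hS.symm h)⟩
  · obtain ⟨r, hr, s, hs, hrs, h1, h2⟩ := testBit_atLeastTwo (by simp) hb
    rw [mem_rotations_iff] at hr hs
    obtain ⟨hi, h1⟩ := hT.rotate hr.2 i x hx h1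
    obtain ⟨-, h2⟩ := hT.rotate hs.2 i x hx h2
    refine ⟨hi, fun h => ?_⟩
    obtain ⟨a, ha, b, hb', hab, hab'⟩ := hS.card x
    -- `i`, `i + r`, `i + s` modulo 7 would be three different members of `{a, b}`.
    rw [hab'] at h h1 h2
    omega

theorem testBit_arc (hT : Within T S) {j k x : ℕ} (hj : j < 7)
    (h : (arc T j k).testBit x = true) : x < 128 ∧ S k (x ^^^ 2 ^ j) := by
  have hx := lt_of_testBit_slice h
  rw [arc, testBit_slice _ _ _ hx] at h
  exact ⟨hx, (hT _ _ (xor_two_pow_lt hx hj) (testBit_translate hj hx h).2).2⟩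

theorem testBit_double (hT : Within T S) {j k x : ℕ} (hj : j < 7) (hk : k < 7)
    (h : (double T j k).testBit x = true) : S k (x ^^^ 2 ^ j) ∧ S j (x ^^^ 2 ^ k) := by
  rw [double, testBit_land, Bool.and_eq_true] at h
  exact ⟨(testBit_arc hT hj h.1).2, (testBit_arc hT hk h.2).2⟩

theorem lt_of_mem_pairs : ∀ p ∈ pairs, p.1 < p.2 ∧ p.2 < 7 := by
  decide

theorem testBit_otherDouble {j k x : ℕ}
    (h : (otherDouble T (atLeastOne (fun p => double T p.1 p.2) pairs)
      (atLeastTwo (fun p => double T p.1 p.2) pairs) j k).testBit x = true) :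
    ∃ p ∈ pairs, p ≠ (cond (Nat.ble j k) j k, cond (Nat.ble j k) k j) ∧
      (double T p.1 p.2).testBit x = true := by
  rw [otherDouble, testBit_lor, Bool.or_eq_true, testBit_xor, testBit_land] at h
  generalize hj' : cond (Nat.ble j k) j k = j' at *
  generalize hk' : cond (Nat.ble j k) k j = k' at *
  rcases h with h | h
  · obtain ⟨p, hp, q, hq, hpq, h1, h2⟩ := testBit_atLeastTwo (by decide) h
    by_cases hp' : p = (j', k')
    · exact ⟨q, hq, fun h => hpq (hp'.trans h.symm), h2⟩
    · exact ⟨p, hp, hp', h1⟩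
  · have h1 : (atLeastOne (fun p => double T p.1 p.2) pairs).testBit x = true := by
      by_contra h1
      simp [h1] at h
    obtain ⟨p, hp, h2⟩ := testBit_atLeastOne h1
    refine ⟨p, hp, ?_, h2⟩
    rintro rfl
    simp [h1, h2] at h

theorem Within.doubleF (hS : AtMostOneDouble S) (hT : Within T S) :
    Within (doubleF T) fun i x => ¬ S i x := by
  rw [CubeBits.doubleF, forceNat_eq, forceNat_eq]
  refine Within.atLeastOne fun k hk i y hy hb => ?_
  have hk := lt_of_mem_directions hk
  obtain ⟨hi, hb⟩ := testBit_translate hk hy hb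
  refine ⟨hi, fun hy' => ?_⟩
  have hx := xor_two_pow_lt hy hk
  rw [← xor_two_pow_self y k] at hy'
  generalize y ^^^ 2 ^ k = x at *
  obtain ⟨j, hj, hb⟩ := testBit_atLeastOne hb
  have hj := lt_of_mem_directions hj
  by_cases hjk : j = k
  · simp [hjk] at hb
  have hbeq : Nat.beq j k = false := Bool.eq_false_iff.2 fun h => hjk (Nat.eq_of_beq_eq_true h)
  rw [hbeq, cond_false, testBit_land, testBit_block _ _ _ hx, testBit_shiftLeft,
    testBit_land, Bool.and_eq_true, Bool.and_eq_true, Bool.and_eq_true,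
    decide_eq_true_eq] at hb
  obtain ⟨rfl, -, h1, h2⟩ := hb
  rw [Nat.add_sub_cancel_left] at h1 h2
  obtain ⟨p, hp, hne, hd⟩ := testBit_otherDouble h1
  have hp := lt_of_mem_pairs p hp
  obtain ⟨hd1, hd2⟩ := testBit_double hT (hp.1.trans hp.2) hp.2 hd
  have h3 := (testBit_arc hT hj h2).2
  rcases lt_or_gt_of_ne hjk with hlt | hlt
  · have hle : Nat.ble i k = true := Nat.ble_eq_true_of_le hlt.le
    rw [hle] at hne
    obtain ⟨h4, h5⟩ := hS hp.1 hp.2 hlt hk hd1 hd2 h3 hy'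
    exact hne (Prod.ext h4 h5)
  · have hle : Nat.ble i k = false := by
      rw [Bool.eq_false_iff, ne_eq, Nat.ble_eq]
      omega
    rw [hle] at hne
    obtain ⟨h4, h5⟩ := hS hp.1 hp.2 hlt hj hd1 hd2 hy' h3
    exact hne (Prod.ext h4 h5)

theorem within_two_pow {P : ℕ → ℕ → Prop} {h : ℕ} (h7 : h / 128 < 7) (hP : P (h / 128) (h % 128)) :
    Within (2 ^ h) P := by
  intro i x hx hb
  rw [Nat.testBit_two_pow, decide_eq_true_eq] at hb
  have h1 : h / 128 = i := by omega
  have h2 : h % 128 = x := by omega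
  rw [h1] at h7
  rw [h1, h2] at hP
  exact ⟨h7, hP⟩

/-- Every rule preserves truth in the model, and one side of every branching agrees with it; along
that path no contradiction can appear, so the search cannot succeed. -/
theorem refute_sound (hS : IsModel S) {b : Bool} (hD : b = true → AtMostOneDouble S) (n : ℕ) :
    ∀ {T F : ℕ} (hs : List ℕ), Within T S → (Within F fun i x => ¬ S i x) →
      refute b n T F hs = none := by
  induction n with
  | zero => exact fun _ _ _ => rfl
  | succ n ih =>
    intro T F hs hT hF
    have hT' := Within.nextT hS hT hF
    have hF' := Within.nextF hS hT hF
    have hF2 : Within (cond b (Nat.lor F (doubleF T)) F) fun i x => ¬ S i x := by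
      cases b with
      | false => exact hF
      | true => exact hF.lor (Within.doubleF (hD rfl) hT)
    rw [show refute b (n + 1) T F hs =
      forceNat (nextT T F) fun T' =>
      forceNat (nextF T F) fun F' =>
      cond (Nat.beq (Nat.land T' F') 0)
        (cond (cond (Nat.beq T T') (Nat.beq F F') false)
          (forceNat (cond b (Nat.lor F (doubleF T)) F) fun F' =>
            cond (Nat.beq F F')
              (List.casesOn hs none fun h hs =>
                cond (Nat.ble h 895)
                  (Option.casesOn (refute b n (Nat.lor T (2 ^ h)) F hs) none fun hs =>
                    refute b n T (Nat.lor F (2 ^ h)) hs)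
                  none)
              (refute b n T F' hs))
          (refute b n T' F' hs))
        (some hs) from rfl, forceNat_eq, forceNat_eq, forceNat_eq]
    -- A common pair would be both an edge and a non-edge of the model.
    have h0 : Nat.land (CubeBits.nextT T F) (CubeBits.nextF T F) = 0 := by
      refine Nat.eq_of_testBit_eq fun c => ?_
      rw [testBit_land, Nat.zero_testBit, Bool.eq_false_iff, ne_eq, Bool.and_eq_true,
        ← Nat.div_add_mod c 128]
      have hc : c % 128 < 128 := Nat.mod_lt _ (by norm_num)
      exact fun h => (hF' _ _ hc h.2).2 (hT' _ _ hc h.1).2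
    rw [h0, show Nat.beq 0 0 = true from rfl, cond_true]
    cases cond (Nat.beq T (CubeBits.nextT T F)) (Nat.beq F (CubeBits.nextF T F)) false with
    | false => exact ih _ hT' hF'
    | true =>
      rw [cond_true]
      cases Nat.beq F (cond b (Nat.lor F (CubeBits.doubleF T)) F) with
      | false => exact ih _ hT hF2
      | true =>
        rw [cond_true]
        cases hs with
        | nil => rfl
        | cons h hs =>
          cases hle : Nat.ble h 895 with
          | false => simp only [hle, cond_false]
          | true =>
            have h7 : h / 128 < 7 := by
              have := Nat.le_of_ble_eq_true hle
              omega
            simp only [hle, cond_true]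
            by_cases hP : S (h / 128) (h % 128)
            · rw [ih hs (hT.lor (within_two_pow h7 hP)) hF]
            · cases refute b n (Nat.lor T (2 ^ h)) F hs with
              | none => rfl
              | some hs' => exact ih hs' hT (hF.lor (within_two_pow h7 hP))

theorem IsModel.lt (hS : IsModel S) {i x : ℕ} (h : S i x) : i < 7 := by
  obtain ⟨a, ha, b, hb, -, hab⟩ := hS.card x
  rcases (hab i).1 h with rfl | rfl <;> assumption

theorem within_edgeSet (hS : IsModel S) {l : List (ℕ × ℕ)} (hl : ∀ p ∈ l, S p.1 p.2)
    (hlt : ∀ p ∈ l, p.2 < 128) : Within (edgeSet l) S := by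
  refine Within.atLeastOne fun p hp => ?_
  have h1 := hlt p hp
  have h2 : (128 * p.1 + p.2) / 128 = p.1 := by omega
  have h3 : (128 * p.1 + p.2) % 128 = p.2 := by omega
  refine within_two_pow (h := 128 * p.1 + p.2) ?_ ?_
  · rw [h2]
    exact hS.lt (hl p hp)
  · rw [h2, h3]
    exact hl p hp

theorem within_zero {P : ℕ → ℕ → Prop} : Within 0 P := by
  intro i x _ h
  simp at h

theorem not_tournament (hS : IsModel S) (h : ∀ p ∈ tournamentEdges, S p.1 p.2) : False := by
  have := refute_tournament
  rw [refute_sound hS (by simp) _ _ (within_edgeSet hS h (by decide)) within_zero] at this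
  exact Bool.false_ne_true this

theorem not_double (hS : IsModel S) (hD : AtMostOneDouble S)
    (h : ∀ p ∈ doubleEdges, S p.1 p.2) : False := by
  have := refute_double
  rw [refute_sound hS (fun _ => hD) _ _ (within_edgeSet hS h (by decide)) within_zero] at this
  exact Bool.false_ne_true this

end Sound

end CubeBits

/-! ### From Hamiltonian cycles to square-free 2-factors. -/

/-- `T v i` says that the edge at `v` in direction `i` is chosen, for a set of edges of `Q_n` that is
spanning, `2`-regular, and contains no two opposite edges of a `4`-cycle. -/
structure IsSquareFreeFactor {n : ℕ} (T : (Fin n → ZMod 2) → Fin n → Prop) : Prop where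
  symm : ∀ {v i}, T v i → T (v + Pi.single i 1) i
  free : ∀ {v i j}, i ≠ j → T v i → ¬ T (v + Pi.single j 1) i
  card : ∀ v, ∃ a b, a ≠ b ∧ ∀ i, T v i ↔ i = a ∨ i = b

section Walks

variable {n : ℕ}

theorem add_single_add_single (v : Fin n → ZMod 2) (i : Fin n) :
    v + Pi.single i 1 + Pi.single i 1 = v := by
  rw [add_assoc, ← Pi.single_add, CharTwo.add_self_eq_zero, Pi.single_zero, add_zero]

theorem hypercube_adj_add_single (v : Fin n → ZMod 2) (i : Fin n) :
    (hypercube n).Adj v (v + Pi.single i 1) := ⟨i, rfl⟩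

theorem add_single_injective (v : Fin n → ZMod 2) :
    Function.Injective fun i : Fin n => v + Pi.single i (1 : ZMod 2) := by
  intro i j h
  have h1 : (Pi.single i 1 : Fin n → ZMod 2) i = (Pi.single j 1 : Fin n → ZMod 2) i :=
    congrFun (add_left_cancel h) i
  by_contra hij
  rw [Pi.single_eq_same, Pi.single_eq_of_ne hij] at h1
  exact one_ne_zero h1

theorem isFourCycle_add_single (v : Fin n → ZMod 2) {i j : Fin n} (hij : i ≠ j) :
    (hypercube n).IsFourCycle v (v + Pi.single i 1) (v + Pi.single i 1 + Pi.single j 1)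
      (v + Pi.single j 1) := by
  have h1 : ∀ (u : Fin n → ZMod 2) (k : Fin n), u ≠ u + Pi.single k 1 := fun u k =>
    (hypercube_adj_add_single u k).ne
  have h2 : v + Pi.single i 1 + Pi.single j 1 = v + Pi.single j 1 + Pi.single i 1 :=
    add_right_comm _ _ _
  refine ⟨?_, ⟨i, rfl⟩, ⟨j, rfl⟩, ⟨i, ?_⟩, ⟨j, (add_single_add_single v j).symm⟩⟩
  · have h3 : v ≠ v + Pi.single i 1 + Pi.single j 1 := fun h => hij (add_single_injective v (by
      change v + Pi.single i 1 = v + Pi.single j 1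
      conv_rhs => rw [h]
      rw [add_single_add_single]))
    have h4 : v + Pi.single i 1 ≠ v + Pi.single j 1 := fun h => hij (add_single_injective v h)
    simp only [List.nodup_cons, List.mem_cons, List.not_mem_nil, or_false, not_or,
      List.nodup_nil, not_false_eq_true, and_true]
    exact ⟨⟨h1 _ _, h3, h1 _ _⟩, ⟨h1 _ _, h4⟩, by rw [h2]; exact (h1 _ _).symm⟩
  · rw [h2, add_single_add_single]

theorem SimpleGraph.Walk.exists_getVert_of_mem_edges {V : Type*} {G : SimpleGraph V} {a b u v : V}
    (p : G.Walk a b) (h : s(u, v) ∈ p.edges) : ∃ i < p.length,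
      (p.getVert i = u ∧ p.getVert (i + 1) = v) ∨ (p.getVert i = v ∧ p.getVert (i + 1) = u) := by
  rw [← SimpleGraph.Walk.mem_edges_toSubgraph, SimpleGraph.Subgraph.mem_edgeSet,
    SimpleGraph.Walk.toSubgraph_adj_iff] at h
  obtain ⟨i, h, hi⟩ := h
  exact ⟨i, hi, Sym2.eq_iff.1 h⟩

theorem containsSquare_of_mem_edges {a : Fin n → ZMod 2} (h : (hypercube n).Walk a a)
    {v : Fin n → ZMod 2} {i j : Fin n} (hij : i ≠ j) (h1 : s(v, v + Pi.single i 1) ∈ h.edges)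
    (h2 : s(v + Pi.single j 1, v + Pi.single j 1 + Pi.single i 1) ∈ h.edges) :
    h.ContainsSquare := by
  rw [add_right_comm] at h2
  obtain ⟨k, hk, hk'⟩ := h.exists_getVert_of_mem_edges h1
  obtain ⟨l, hl, hl'⟩ := h.exists_getVert_of_mem_edges h2
  have hc := isFourCycle_add_single v hij
  have hc' := isFourCycle_add_single (v + Pi.single i 1) hij
  rw [add_single_add_single] at hc'
  -- Opposite edges traversed in the same direction give a twisted square, in opposite directions a
  -- straight one.
  rcases hk' with ⟨k1, k2⟩ | ⟨k1, k2⟩ <;> rcases hl' with ⟨l1, l2⟩ | ⟨l1, l2⟩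
  · exact ⟨_, _, _, _, Or.inr ⟨hc, k, hk, l, hl, k1, k2, l1, l2⟩⟩
  · exact ⟨_, _, _, _, Or.inl ⟨hc, k, hk, l, hl, k1, k2, l1, l2⟩⟩
  · exact ⟨_, _, _, _, Or.inl ⟨hc', k, hk, l, hl, k1, k2, l1, l2⟩⟩
  · exact ⟨_, _, _, _, Or.inr ⟨hc', k, hk, l, hl, k1, k2, l1, l2⟩⟩

theorem isSquareFreeFactor_of_not_containsSquare {a : Fin n → ZMod 2}
    (h : (hypercube n).Walk a a) (hh : h.IsHamiltonianCycle) (hs : ¬ h.ContainsSquare) :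
    IsSquareFreeFactor fun v i => s(v, v + Pi.single i 1) ∈ h.edges where
  symm {v i} hv := by
    rwa [add_single_add_single, Sym2.eq_swap]
  free {v i j} hij h1 h2 := hs (containsSquare_of_mem_edges h hij h1 h2)
  card v := by
    have h1 := hh.isCycle.ncard_neighborSet_toSubgraph_eq_two (hh.mem_support v)
    rw [Set.ncard_eq_two] at h1
    obtain ⟨x, y, hxy, h1⟩ := h1
    have hadj : ∀ w, s(v, w) ∈ h.edges ↔ w = x ∨ w = y := fun w => by
      rw [← SimpleGraph.Walk.mem_edges_toSubgraph, SimpleGraph.Subgraph.mem_edgeSet,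
        ← SimpleGraph.Subgraph.mem_neighborSet, h1]
      rfl
    obtain ⟨i, rfl⟩ := h.adj_of_mem_edges ((hadj x).2 (Or.inl rfl))
    obtain ⟨j, rfl⟩ := h.adj_of_mem_edges ((hadj y).2 (Or.inr rfl))
    refine ⟨i, j, fun h => hxy (by rw [h]), fun k => ?_⟩
    rw [hadj, (add_single_injective v).eq_iff, (add_single_injective v).eq_iff]

end Walks

/-! ### Counting doubles; the dimensions below seven. -/

namespace IsSquareFreeFactor

open Finset
open scoped Classical

variable {n : ℕ} {T : (Fin n → ZMod 2) → Fin n → Prop}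

theorem iff_add_single (hT : IsSquareFreeFactor T) {v : Fin n → ZMod 2} {i : Fin n} :
    T (v + Pi.single i 1) i ↔ T v i :=
  ⟨fun h => by simpa only [add_single_add_single] using hT.symm h, hT.symm⟩

theorem card_directions (hT : IsSquareFreeFactor T) (v : Fin n → ZMod 2) :
    #{i | T v i} = 2 := by
  obtain ⟨a, b, hab, h⟩ := hT.card v
  rw [Finset.card_eq_two]
  exact ⟨a, b, hab, by ext i; simp [h]⟩

theorem card_directions_not (hT : IsSquareFreeFactor T) (v : Fin n → ZMod 2) :
    #{i | ¬ T v i} = n - 2 := by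
  have h := card_filter_add_card_filter_not (s := (univ : Finset (Fin n))) (T v)
  rw [hT.card_directions, card_univ, Fintype.card_fin] at h
  omega

/-- The pairs of directions `j ≠ k` such that the vertex of a square through `v` opposite to `v` has
its two chosen edges in the directions `j` and `k` of that square. -/
noncomputable def doubles (T : (Fin n → ZMod 2) → Fin n → Prop) (v : Fin n → ZMod 2) :
    Finset (Fin n × Fin n) :=
  {p | p.1 ≠ p.2 ∧ T (v + Pi.single p.1 1) p.2 ∧ T (v + Pi.single p.2 1) p.1}

theorem mem_doubles {v : Fin n → ZMod 2} {j k : Fin n} : (j, k) ∈ doubles T v ↔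
    j ≠ k ∧ T (v + Pi.single j 1) k ∧ T (v + Pi.single k 1) j := by
  simp [doubles]

theorem swap_mem_doubles {v : Fin n → ZMod 2} {j k : Fin n} (h : (j, k) ∈ doubles T v) :
    (k, j) ∈ doubles T v := by
  rw [mem_doubles] at h ⊢
  exact ⟨h.1.symm, h.2.2, h.2.1⟩

/-- Translation by `e_j + e_k` turns the doubles `(j, k)` into the ordered pairs of distinct chosen
directions, two at each vertex. -/
theorem sum_card_doubles (hT : IsSquareFreeFactor T) :
    ∑ v, #(doubles T v) = 2 ^ n * 2 := by
  have h1 : ∀ p : Fin n × Fin n, #{v | p ∈ doubles T v} = #{v | p.1 ≠ p.2 ∧ T v p.1 ∧ T v p.2} := by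
    rintro ⟨j, k⟩
    refine card_equiv (Equiv.addRight (Pi.single j 1 + Pi.single k 1)) fun v => ?_
    simp only [mem_filter, mem_univ, true_and, mem_doubles, Equiv.coe_addRight, ← add_assoc]
    rw [hT.iff_add_single (v := v + Pi.single j 1), add_right_comm, hT.iff_add_single]
    tauto
  calc ∑ v, #(doubles T v) = ∑ v, ∑ p, if p ∈ doubles T v then 1 else 0 := by simp
    _ = ∑ p : Fin n × Fin n, #{v | p.1 ≠ p.2 ∧ T v p.1 ∧ T v p.2} := by
      rw [sum_comm]
      simp [← h1]
    _ = ∑ v : Fin n → ZMod 2, ∑ p : Fin n × Fin n,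
        if p.1 ≠ p.2 ∧ T v p.1 ∧ T v p.2 then 1 else 0 := by
      rw [sum_comm]
      simp
    _ = ∑ v : Fin n → ZMod 2, 2 := by
      refine sum_congr rfl fun v _ => ?_
      have h2 := offDiag_card ({i | T v i} : Finset (Fin n))
      rw [hT.card_directions] at h2
      rw [sum_boole, Nat.cast_id, show 2 = 2 * 2 - 2 from rfl, ← h2]
      congr 1
      ext p
      simp only [mem_filter, mem_univ, true_and, mem_offDiag]
      tauto
    _ = 2 ^ n * 2 := by simp [ZMod.card]

/-- The pairs `(j, k)` such that `j` is not a direction at `v`, but `k` is one at the neighbour of `v`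
in direction `j`. -/
noncomputable def arcs (T : (Fin n → ZMod 2) → Fin n → Prop) (v : Fin n → ZMod 2) :
    Finset (Fin n × Fin n) :=
  {p | ¬ T v p.1 ∧ T (v + Pi.single p.1 1) p.2}

theorem card_arcs (hT : IsSquareFreeFactor T) (v : Fin n → ZMod 2) :
    #(arcs T v) = (n - 2) * 2 := by
  rw [arcs, card_filter, ← univ_product_univ, sum_product]
  calc ∑ j, ∑ k, (if ¬ T v j ∧ T (v + Pi.single j 1) k then 1 else 0)
      = ∑ j, if ¬ T v j then 2 else 0 := by
        refine sum_congr rfl fun j _ => ?_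
        split_ifs with h
        · simp [h]
        · simp [h, hT.card_directions]
    _ = (n - 2) * 2 := by
        rw [← sum_filter, sum_const, hT.card_directions_not, smul_eq_mul]

/-- `k = j` would make `j` chosen at `v`; `k` chosen at `v` would give two opposite edges of a
square. -/
theorem arcs_subset (hT : IsSquareFreeFactor T) (v : Fin n → ZMod 2) :
    arcs T v ⊆ ({i | ¬ T v i} : Finset (Fin n)).offDiag := by
  rintro ⟨j, k⟩ h
  simp only [arcs, mem_filter, mem_univ, true_and, mem_offDiag] at h ⊢
  have hjk : j ≠ k := by
    rintro rfl
    exact h.1 (hT.iff_add_single.1 h.2)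
  exact ⟨h.1, fun hk => hT.free hjk.symm hk h.2, hjk⟩

theorem arcs_union_swap_subset (hT : IsSquareFreeFactor T) (v : Fin n → ZMod 2) :
    arcs T v ∪ (arcs T v).map (Equiv.prodComm _ _).toEmbedding ⊆
      ({i | ¬ T v i} : Finset (Fin n)).offDiag := by
  refine union_subset (hT.arcs_subset v) fun p hp => ?_
  obtain ⟨q, hq, rfl⟩ := mem_map.1 hp
  have := hT.arcs_subset v hq
  rw [mem_offDiag] at this ⊢
  exact ⟨this.2.1, this.1, this.2.2.symm⟩

theorem arcs_inter_swap_subset (hT : IsSquareFreeFactor T) (v : Fin n → ZMod 2) :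
    arcs T v ∩ (arcs T v).map (Equiv.prodComm _ _).toEmbedding ⊆ doubles T v := by
  rintro ⟨j, k⟩ h
  rw [mem_inter, mem_map_equiv] at h
  have h1 := hT.arcs_subset v h.1
  rw [mem_offDiag] at h1
  simp only [arcs, mem_filter, mem_univ, true_and, Equiv.prodComm_symm, Equiv.prodComm_apply,
    Prod.swap_prod_mk] at h
  exact mem_doubles.2 ⟨h1.2.2, h.1.2, h.2.2⟩

theorem card_arcs_union_swap (hT : IsSquareFreeFactor T) (v : Fin n → ZMod 2) :
    (n - 2) * 4 ≤ #(arcs T v ∪ (arcs T v).map (Equiv.prodComm _ _).toEmbedding) +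
      #(doubles T v) := by
  have h1 := card_union_add_card_inter (arcs T v) ((arcs T v).map (Equiv.prodComm _ _).toEmbedding)
  have h2 := card_le_card (hT.arcs_inter_swap_subset v)
  rw [card_map, hT.card_arcs] at h1
  omega

theorem card_offDiag_filter_not (hT : IsSquareFreeFactor T) (v : Fin n → ZMod 2) :
    #({i | ¬ T v i} : Finset (Fin n)).offDiag = (n - 2) * (n - 2) - (n - 2) := by
  rw [offDiag_card, hT.card_directions_not]

theorem le_card_doubles (hT : IsSquareFreeFactor T) (v : Fin n → ZMod 2) :
    (n - 2) * 4 ≤ (n - 2) * (n - 2) - (n - 2) + #(doubles T v) :=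
  (hT.card_arcs_union_swap v).trans (Nat.add_le_add_right
    ((card_le_card (hT.arcs_union_swap_subset v)).trans_eq (hT.card_offDiag_filter_not v)) _)

theorem false_of_lt_seven (hT : IsSquareFreeFactor T) (h2 : 2 ≤ n) (h7 : n < 7) : False := by
  have h1 : (2 : ℕ) ^ n * ((n - 2) * 4) ≤ 2 ^ n * ((n - 2) * (n - 2) - (n - 2)) + 2 ^ n * 2 := by
    have h3 : #(univ : Finset (Fin n → ZMod 2)) = 2 ^ n := by simp [ZMod.card]
    rw [← hT.sum_card_doubles, ← h3, ← smul_eq_mul, ← smul_eq_mul (b := _ - _), ← sum_const,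
      ← sum_const, ← sum_add_distrib]
    exact sum_le_sum fun v _ => hT.le_card_doubles v
  rw [← mul_add] at h1
  have h4 := Nat.le_of_mul_le_mul_left h1 (by positivity)
  interval_cases n
  -- For `n = 2` the count gives nothing, but both directions are chosen at every vertex, which
  -- yields opposite edges.
  · obtain ⟨a, b, hab, h⟩ := hT.card 0
    obtain ⟨c, d, hcd, h'⟩ := hT.card (0 + Pi.single b 1)
    refine hT.free hab ((h a).2 (Or.inl rfl)) ((h' a).2 ?_)
    omega
  all_goals omega

end IsSquareFreeFactor

/-! ### Combinatorics for the normalisation of directions. -/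

theorem exists_perm_extending {α : Type*} [Fintype α] [DecidableEq α] {s : Finset α} {f : α → α}
    (hf : Set.InjOn f s) : ∃ σ : Equiv.Perm α, ∀ i ∈ s, σ i = f i := by
  obtain ⟨g, hg⟩ := Finset.exists_equiv_extend_of_card_eq (t := Finset.univ) Finset.card_univ.symm
    (Finset.subset_univ (s.image f)) hf
  exact ⟨g.trans (Equiv.subtypeUnivEquiv Finset.mem_univ), hg⟩

/-- A regular tournament on five vertices is cyclic. -/
theorem exists_cyclic_tournament {α : Type*} [DecidableEq α] {O : Finset α} (hO : O.card = 5)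
    {R : α → α → Prop} (h2 : ∀ j ∈ O, ∃ a b, a ≠ b ∧ ∀ k, R j k ↔ k = a ∨ k = b)
    (hsub : ∀ j ∈ O, ∀ k, R j k → k ∈ O ∧ j ≠ k)
    (hor : ∀ j ∈ O, ∀ k ∈ O, j ≠ k → R j k ∨ R k j) :
    ∃ a b c d e, (∀ x ∈ [a, b, c, d, e], x ∈ O) ∧ [a, b, c, d, e].Nodup ∧ R a b ∧ R a c ∧ R b c ∧
      R b d ∧ R c d ∧ R c e ∧ R d e ∧ R d a ∧ R e a ∧ R e b := by
  -- Once two out-neighbours are known, all other arcs at that vertex point inwards. With `b → c`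
  -- the out-neighbours of `a` and `d → e` the remaining vertices, this determines everything.
  have hne : ∀ {j}, j ∈ O → ∀ {p q r}, R j p → R j q → p ≠ q → r ≠ p → r ≠ q → ¬ R j r := by
    intro j hj p q r hp hq hpq hrp hrq hr
    obtain ⟨a, b, -, h⟩ := h2 j hj
    rw [h] at hp hq hr
    grind
  obtain ⟨a, ha⟩ : O.Nonempty := Finset.card_pos.1 (by omega)
  obtain ⟨b, c, hb, hc, hbc, hab, hac, hbc'⟩ : ∃ b c, b ∈ O ∧ c ∈ O ∧ b ≠ c ∧ R a b ∧ R a c ∧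
      R b c := by
    obtain ⟨b, c, hbc, h⟩ := h2 a ha
    have hb := (h b).2 (Or.inl rfl)
    have hc := (h c).2 (Or.inr rfl)
    have hb' := (hsub a ha b hb).1
    have hc' := (hsub a ha c hc).1
    rcases hor b hb' c hc' hbc with h | h
    · exact ⟨b, c, hb', hc', hbc, hb, hc, h⟩
    · exact ⟨c, b, hc', hb', hbc.symm, hc, hb, h⟩
  have hab' := (hsub a ha b hab).2
  have hac' := (hsub a ha c hac).2
  obtain ⟨d, e, hd, he, hde, hde'⟩ : ∃ d e, d ∈ O \ {a, b, c} ∧ e ∈ O \ {a, b, c} ∧ d ≠ e ∧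
      R d e := by
    have hcard : (O \ {a, b, c}).card = 2 := by
      rw [Finset.card_sdiff_of_subset (by
        intro x hx
        simp only [Finset.mem_insert, Finset.mem_singleton] at hx
        rcases hx with rfl | rfl | rfl <;> assumption), hO,
        Finset.card_eq_three.2 ⟨a, b, c, hab', hac', hbc, rfl⟩]
    obtain ⟨d, e, hde, h⟩ := Finset.card_eq_two.1 hcard
    have hd : d ∈ O \ {a, b, c} := by simp [h]
    have he : e ∈ O \ {a, b, c} := by simp [h]
    rcases hor d (Finset.mem_sdiff.1 hd).1 e (Finset.mem_sdiff.1 he).1 hde with h | h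
    · exact ⟨d, e, hd, he, hde, h⟩
    · exact ⟨e, d, he, hd, hde.symm, h⟩
  simp only [Finset.mem_sdiff, Finset.mem_insert, Finset.mem_singleton, not_or] at hd he
  obtain ⟨hd, hda, hdb, hdc⟩ := hd
  obtain ⟨he, hea, heb, hec⟩ := he
  have hda' : R d a := (hor d hd a ha hda).resolve_right (hne ha hab hac hbc hdb hdc)
  have hea' : R e a := (hor e he a ha hea).resolve_right (hne ha hab hac hbc heb hec)
  have hbd : R b d := (hor b hb d hd (Ne.symm hdb)).resolve_right
    (hne hd hde' hda' hea (Ne.symm heb) hab'.symm)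
  have hcd : R c d := (hor c hc d hd (Ne.symm hdc)).resolve_right
    (hne hd hde' hda' hea (Ne.symm hec) hac'.symm)
  have heb' : R e b := (hor e he b hb heb).resolve_right
    (hne hb hbc' hbd (Ne.symm hdc) hec hde.symm)
  have hce : R c e := (hor c hc e he (Ne.symm hec)).resolve_right
    (hne he hea' heb' hab' hac'.symm hbc.symm)
  refine ⟨a, b, c, d, e, ?_, ?_, hab, hac, hbc', hbd, hcd, hce, hde', hda', hea', heb'⟩
  · simp [ha, hb, hc, hd, he]
  · simp only [List.nodup_cons, List.mem_cons, List.not_mem_nil, or_false, not_or, List.nodup_nil,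
      not_false_eq_true, and_true]
    exact ⟨⟨hab', hac', Ne.symm hda, Ne.symm hea⟩, ⟨hbc, Ne.symm hdb, Ne.symm heb⟩,
      ⟨Ne.symm hdc, Ne.symm hec⟩, hde⟩

/-! ### Dimension seven. -/

namespace IsSquareFreeFactor

open Finset
open scoped Classical

/-- The vertex with coordinates the bits of `x`, for the origin `v` and the directions permuted by
`σ`. -/
def vertex (v : Fin 7 → ZMod 2) (σ : Equiv.Perm (Fin 7)) (x : ℕ) : Fin 7 → ZMod 2 :=
  fun i => v i + if x.testBit (σ.symm i) then 1 else 0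

theorem vertex_zero (v : Fin 7 → ZMod 2) (σ : Equiv.Perm (Fin 7)) : vertex v σ 0 = v := by
  ext i
  simp [vertex]

theorem vertex_xor (v : Fin 7 → ZMod 2) (σ : Equiv.Perm (Fin 7)) (x : ℕ) (j : Fin 7) :
    vertex v σ (x ^^^ 2 ^ (j : ℕ)) = vertex v σ x + Pi.single (σ j) 1 := by
  funext i
  rw [Pi.add_apply, vertex, vertex, Nat.testBit_xor, Nat.testBit_two_pow, add_assoc]
  congr 1
  by_cases hi : i = σ j
  · subst hi
    rw [Equiv.symm_apply_apply, Pi.single_eq_same]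
    cases x.testBit j <;> simp [CharTwo.add_self_eq_zero]
  · have : (j : ℕ) ≠ σ.symm i := fun h => hi (by
      rw [Fin.ext h, Equiv.apply_symm_apply])
    rw [Pi.single_eq_of_ne hi, add_zero]
    simp [this]

theorem vertex_two_pow (v : Fin 7 → ZMod 2) (σ : Equiv.Perm (Fin 7)) (j : Fin 7) :
    vertex v σ (2 ^ (j : ℕ)) = v + Pi.single (σ j) 1 := by
  rw [← Nat.zero_xor (2 ^ (j : ℕ)), vertex_xor, vertex_zero]

/-- The pullback of `T` along the cube automorphism taking `0` to `v` and direction `j` to `σ j`.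
Only the low seven bits of `x` matter. -/
def model (T : (Fin 7 → ZMod 2) → Fin 7 → Prop) (v : Fin 7 → ZMod 2) (σ : Equiv.Perm (Fin 7))
    (i x : ℕ) : Prop :=
  ∃ h : i < 7, T (vertex v σ x) (σ ⟨i, h⟩)

variable {T : (Fin 7 → ZMod 2) → Fin 7 → Prop}

theorem isModel (hT : IsSquareFreeFactor T) (v : Fin 7 → ZMod 2) (σ : Equiv.Perm (Fin 7)) :
    CubeBits.IsModel (model T v σ) where
  symm := by
    rintro i x ⟨hi, h⟩
    refine ⟨hi, ?_⟩
    rw [vertex_xor v σ x ⟨i, hi⟩]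
    exact hT.symm h
  free := by
    rintro i j x hj hij ⟨hi, h⟩ ⟨_, h'⟩
    rw [vertex_xor v σ x ⟨j, hj⟩] at h'
    exact hT.free (fun h => hij (by simpa using h)) h h'
  card x := by
    obtain ⟨a, b, hab, h⟩ := hT.card (vertex v σ x)
    refine ⟨σ.symm a, (σ.symm a).2, σ.symm b, (σ.symm b).2,
      fun h => hab (σ.symm.injective (Fin.ext h)), fun i => ?_⟩
    constructor
    · rintro ⟨hi, h'⟩
      rw [h, ← Equiv.eq_symm_apply, ← Equiv.eq_symm_apply, Fin.ext_iff, Fin.ext_iff] at h'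
      exact h'
    · rintro (rfl | rfl)
      · exact ⟨(σ.symm a).2, (h _).2 (Or.inl (by simp))⟩
      · exact ⟨(σ.symm b).2, (h _).2 (Or.inr (by simp))⟩

theorem model_zero {v : Fin 7 → ZMod 2} {σ : Equiv.Perm (Fin 7)} (i : Fin 7) (h : T v (σ i)) :
    model T v σ i 0 :=
  ⟨i.2, by rwa [vertex_zero]⟩

theorem model_two_pow {v : Fin 7 → ZMod 2} {σ : Equiv.Perm (Fin 7)} (i j : Fin 7)
    (h : T (v + Pi.single (σ j) 1) (σ i)) : model T v σ i (2 ^ (j : ℕ)) :=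
  ⟨i.2, by rwa [vertex_two_pow]⟩

theorem mem_doubles_of_model {v : Fin 7 → ZMod 2} {σ : Equiv.Perm (Fin 7)} {x j k : ℕ} (hjk : j < k)
    (hk : k < 7) (h1 : model T v σ k (x ^^^ 2 ^ j)) (h2 : model T v σ j (x ^^^ 2 ^ k)) :
    (σ ⟨j, hjk.trans hk⟩, σ ⟨k, hk⟩) ∈ doubles T (vertex v σ x) := by
  obtain ⟨_, h1⟩ := h1
  obtain ⟨_, h2⟩ := h2
  rw [vertex_xor v σ x ⟨j, hjk.trans hk⟩] at h1
  rw [vertex_xor v σ x ⟨k, hk⟩] at h2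
  exact mem_doubles.2 ⟨fun h => hjk.ne (by simpa using h), h1, h2⟩

/-- `doubles` holds ordered pairs, so a pair and its swap exhaust it. -/
theorem atMostOneDouble (hD : ∀ v, #(doubles T v) = 2) (v : Fin 7 → ZMod 2)
    (σ : Equiv.Perm (Fin 7)) : CubeBits.AtMostOneDouble (model T v σ) := by
  intro x j k l m hjk hk hlm hm h1 h2 h3 h4
  have h5 := mem_doubles_of_model hjk hk h1 h2
  have h6 := mem_doubles_of_model hlm hm h3 h4
  have h7 := swap_mem_doubles h5
  have hne : ((σ ⟨j, hjk.trans hk⟩, σ ⟨k, hk⟩) : Fin 7 × Fin 7) ≠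
      (σ ⟨k, hk⟩, σ ⟨j, hjk.trans hk⟩) := fun h =>
    hjk.ne (by simpa using (Prod.ext_iff.1 h).1)
  have h8 := eq_of_subset_of_card_le (s := {(σ ⟨j, hjk.trans hk⟩, σ ⟨k, hk⟩),
    (σ ⟨k, hk⟩, σ ⟨j, hjk.trans hk⟩)}) (t := doubles T (vertex v σ x))
    (by simp [insert_subset_iff, h5, h7]) (by rw [hD, card_pair hne])
  rw [← h8] at h6
  simp only [mem_insert, mem_singleton, Prod.mk.injEq, EmbeddingLike.apply_eq_iff_eq,
    Fin.mk.injEq] at h6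
  omega

theorem false_of_card_doubles (hT : IsSquareFreeFactor T) (hD : ∀ v, #(doubles T v) = 2) :
    False := by
  obtain ⟨⟨j, k⟩, hjk⟩ : (doubles T 0).Nonempty := card_pos.1 (by rw [hD]; norm_num)
  obtain ⟨hne, h1, h2⟩ := mem_doubles.1 hjk
  obtain ⟨a, b, hab, h⟩ := hT.card 0
  have ha := (h a).2 (Or.inl rfl)
  have hb := (h b).2 (Or.inr rfl)
  have hj : ¬ T 0 j := fun hj => hT.free hne hj h2
  have hk : ¬ T 0 k := fun hk => hT.free hne.symm hk h1
  have hja : j ≠ a := by rintro rfl; exact hj ha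
  have hjb : j ≠ b := by rintro rfl; exact hj hb
  have hka : k ≠ a := by rintro rfl; exact hk ha
  have hkb : k ≠ b := by rintro rfl; exact hk hb
  -- The entries at 2, 3, 4 are fillers outside the prescribed set.
  obtain ⟨σ, hσ⟩ := exists_perm_extending (s := {0, 1, 5, 6}) (f := ![j, k, j, j, j, a, b]) (by
    intro x hx y hy hxy
    simp only [coe_insert, coe_singleton, Set.mem_insert_iff, Set.mem_singleton_iff] at hx hy
    rcases hx with rfl | rfl | rfl | rfl <;> rcases hy with rfl | rfl | rfl | rfl <;>
      first | rfl | exact absurd hxy ‹_› | exact absurd hxy.symm ‹_›)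
  have h0 : σ 0 = j := hσ 0 (by simp)
  have h1' : σ 1 = k := hσ 1 (by simp)
  have h5 : σ 5 = a := hσ 5 (by simp)
  have h6 : σ 6 = b := hσ 6 (by simp)
  refine CubeBits.not_double (hT.isModel 0 σ) (atMostOneDouble hD 0 σ) ?_
  simp only [CubeBits.doubleEdges, List.forall_mem_cons, List.not_mem_nil, false_imp_iff,
    implies_true, and_true]
  exact ⟨model_zero 5 (h5 ▸ ha), model_zero 6 (h6 ▸ hb), model_two_pow 1 0 (by rwa [h0, h1']),
    model_two_pow 0 1 (by rwa [h0, h1'])⟩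

theorem false_of_doubles_eq_empty (hT : IsSquareFreeFactor T) {v : Fin 7 → ZMod 2}
    (hD : doubles T v = ∅) : False := by
  have hO := hT.card_directions_not v
  have hor : ∀ j ∈ ({i | ¬ T v i} : Finset (Fin 7)), ∀ k ∈ ({i | ¬ T v i} : Finset (Fin 7)),
      j ≠ k → T (v + Pi.single j 1) k ∨ T (v + Pi.single k 1) j := by
    intro j hj k hk hjk
    have h1 := hT.card_arcs_union_swap v
    rw [hD, card_empty] at h1
    -- Without doubles, the 10 arcs and their 10 reversals are distinct and fill all `5 * 4` ordered
    -- pairs, so the arcs form a tournament.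
    have h2 := eq_of_subset_of_card_le (hT.arcs_union_swap_subset v)
      ((hT.card_offDiag_filter_not v).trans_le h1)
    have h3 : (j, k) ∈ ({i | ¬ T v i} : Finset (Fin 7)).offDiag := mem_offDiag.2 ⟨hj, hk, hjk⟩
    rw [← h2, mem_union, mem_map_equiv] at h3
    simp only [arcs, mem_filter, mem_univ, true_and, Equiv.prodComm_symm, Equiv.prodComm_apply,
      Prod.swap_prod_mk] at h3
    exact h3.imp And.right And.right
  have hsub : ∀ j ∈ ({i | ¬ T v i} : Finset (Fin 7)), ∀ k, T (v + Pi.single j 1) k →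
      k ∈ ({i | ¬ T v i} : Finset (Fin 7)) ∧ j ≠ k := by
    intro j hj k hjk
    have := hT.arcs_subset v (show (j, k) ∈ arcs T v by simp_all [arcs])
    exact (mem_offDiag.1 this).2
  obtain ⟨a, b, c, d, e, hmem, hnodup, hab, hac, hbc, hbd, hcd, hce, hde, hda, hea, heb⟩ :=
    exists_cyclic_tournament hO (R := fun j k => T (v + Pi.single j 1) k)
      (fun j _ => hT.card _) hsub hor
  obtain ⟨f, g, hfg, h⟩ := hT.card v
  have hf := (h f).2 (Or.inl rfl)
  have hg := (h g).2 (Or.inr rfl)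
  have hne : ∀ x ∈ [a, b, c, d, e], x ≠ f ∧ x ≠ g := by
    intro x hx
    have h1 := (mem_filter.1 (hmem x hx)).2
    exact ⟨by rintro rfl; exact h1 hf, by rintro rfl; exact h1 hg⟩
  have hinj : Function.Injective ![a, b, c, d, e, f, g] := by
    rw [← List.nodup_ofFn]
    simp only [List.nodup_cons, List.mem_cons, List.not_mem_nil, or_false, not_or] at hne hnodup
    simp [List.ofFn_succ, hnodup, hne, hfg]
  obtain ⟨σ, hσ⟩ := exists_perm_extending (s := univ) hinj.injOn
  have hσ : ∀ i, σ i = ![a, b, c, d, e, f, g] i := fun i => hσ i (mem_univ i)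
  refine CubeBits.not_tournament (hT.isModel v σ) ?_
  simp only [CubeBits.tournamentEdges, List.forall_mem_cons, List.not_mem_nil, false_imp_iff,
    implies_true, and_true]
  have key : ∀ i j : Fin 7, T (v + Pi.single (![a, b, c, d, e, f, g] j) 1)
      (![a, b, c, d, e, f, g] i) → model T v σ i (2 ^ (j : ℕ)) := fun i j h =>
    model_two_pow i j (by rwa [hσ, hσ])
  exact ⟨model_zero 5 (by rwa [hσ]), model_zero 6 (by rwa [hσ]), key 1 0 hab, key 2 0 hac,
    key 2 1 hbc, key 3 1 hbd, key 3 2 hcd, key 4 2 hce, key 4 3 hde, key 0 3 hda, key 0 4 hea,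
    key 1 4 heb⟩

theorem false_of_seven (hT : IsSquareFreeFactor T) : False := by
  by_cases hD : ∃ v, doubles T v = ∅
  · exact hT.false_of_doubles_eq_empty hD.choose_spec
  · have h2 : ∀ v, 2 ≤ #(doubles T v) := by
      intro v
      obtain ⟨⟨j, k⟩, h⟩ := nonempty_iff_ne_empty.2 fun h => hD ⟨v, h⟩
      have hne : (j, k) ≠ (k, j) := fun h' => (mem_doubles.1 h).1 (Prod.ext_iff.1 h').1
      rw [← card_pair hne]
      exact card_le_card (by simp [insert_subset_iff, h, swap_mem_doubles h])
    have h3 : ∑ _v : Fin 7 → ZMod 2, 2 = ∑ v, #(doubles T v) := by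
      rw [hT.sum_card_doubles]
      simp [ZMod.card]
    -- At least 2 everywhere and 2 on average, hence 2 everywhere.
    have h4 := (sum_eq_sum_iff_of_le fun v _ => h2 v).1 h3
    exact hT.false_of_card_doubles fun v => (h4 v (mem_univ v)).symm

end IsSquareFreeFactor

theorem mainTheorem4 (n : ℕ) (hn : 2 ≤ n) (hn' : n ≤ 7) (a : Fin n → ZMod 2)
    (h : (hypercube n).Walk a a) (hh : h.IsHamiltonianCycle) : h.ContainsSquare := by
  by_contra hs
  have hT := isSquareFreeFactor_of_not_containsSquare h hh hs
  rcases hn'.lt_or_eq with h7 | rfl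
  · exact hT.false_of_lt_seven hn h7
  · exact hT.false_of_seven
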